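/- Let $k$ be a field, $F$ a free group, and $kF$ the group algebra of $F$ over $k$. Let $u\in kF\setminus k$, and suppose that the support of $u$ (the set of elements of $F$ that appear in $u$ with nonzero coefficient) is contained in some cyclic subgroup of $F$. Then among the cyclic subgroups of $F$ that contain the support of $u$ there is a largest one, $Z$ (it contains all the others), and the centralizer of $u$ in $kF$ is equal to the subalgebra $kZ\subseteq kF$, the group algebra of $Z$. Moreover, this centralizer is isomorphic, as a $k$-algebra, to the algebra of Laurent polynomials $k[t,t^{-1}]$. -/

import Mathlib

/-- The group algebra `k[Z]` of a subgroup `Z` of `F`, as a subalgebra of `k[F]`: the image of the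
`k`-algebra map `k[Z] → k[F]` induced by the inclusion. -/
noncomputable def groupSubalgebra (k : Type*) [Field k] {F : Type*} [Group F] (Z : Subgroup F) :
    Subalgebra k (MonoidAlgebra k F) :=
  (MonoidAlgebra.mapDomainAlgHom k k Z.subtype).range

/-- The support of `u` is contained in the subgroup `Z`. -/
def SupportedOn {k : Type*} [Field k] {F : Type*} [Group F] (u : MonoidAlgebra k F)
    (Z : Subgroup F) : Prop :=
  (u.coeff.support : Set F) ⊆ (Z : Set F)

/-!
Since `u` is not a scalar, its support contains some `g ≠ 1`. The centralizer `Z` of `g` in `F` is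
free by Nielsen–Schreier and has the nontrivial central element `g`, so it has rank one: in a free
group of rank at least two, a nontrivial reduced word never commutes with every letter. Thus `Z` is
infinite cyclic, and it contains every cyclic subgroup that contains `g`, in particular every cyclic
subgroup that contains the support of `u`.

The algebra `k[Z]` is commutative and contains `u`, so it centralizes `u`. For the converse, let `z`
generate `Z` and let `f ∉ Z`. The subgroup `Z` is malnormal: a relation `f zⁱ f⁻¹ = zʲ` with `i ≠ 0`
forces `|i| = |j|`, by comparing the growth of the lengths of powers, and then `f` commutes with `z`
because roots in free groups are unique. Hence the elements `zᵃ f zᵇ` of the double coset `Z f Z` are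
pairwise distinct, and the part of `v` supported there is a Laurent polynomial in two
variables `x`, `y`, on which left and right multiplication by `u` are multiplication by `u(x)` and
`u(y)`. If `v` commutes with `u`, comparing the terms of top degree in `x` shows that this part is
zero (`MonoidAlgebra.coeff_eq_zero_of_commute_of_pos`). So `v` is supported on `Z`.
-/

/-! ### Words and powers in free groups -/

/-- If a reduced word `w` commutes with the one-letter word `ℓ`, where `ℓ` cancels against neither
end of `w`, then `ℓ :: w = w ++ [ℓ]` as words, so `w` begins with `ℓ`. When there are two
generators, `ℓ` can be chosen to be on a different generator from the first letter of `w`. -/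
theorem FreeGroup.subsingleton_of_commute_all {X : Type*} {x : FreeGroup X} (hx : x ≠ 1)
    (hc : ∀ y, Commute x y) : Subsingleton X := by
  classical
  by_contra hX
  rw [not_subsingleton_iff_nontrivial] at hX
  have hw : x.toWord ≠ [] := by simpa using hx
  obtain ⟨s, w, hs⟩ := List.exists_cons_of_ne_nil hw
  obtain ⟨w', t, ht⟩ := List.eq_nil_or_concat x.toWord |>.resolve_left hw
  obtain ⟨c, hcs⟩ := exists_ne s.1
  have hred : FreeGroup.IsReduced x.toWord := FreeGroup.isReduced_toWord
  -- The letter `(c, t.2)` is on another generator than `s` and has the same sign as `t`, so it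
  -- cancels neither against `s` on the left nor against `t` on the right.
  have h₁ : FreeGroup.IsReduced ((c, t.2) :: x.toWord) := by
    rw [hs] at hred ⊢
    rw [FreeGroup.isReduced_cons_cons]
    exact ⟨fun h => absurd h hcs, hred⟩
  have h₂ : FreeGroup.IsReduced (x.toWord ++ [(c, t.2)]) := by
    rw [ht, List.concat_eq_append] at hred ⊢
    exact List.isChain_append.2 ⟨hred, by simp, by simp⟩
  have key := congrArg FreeGroup.toWord (hc (FreeGroup.mk [(c, t.2)])).eq
  rw [← FreeGroup.mk_toWord (x := x), FreeGroup.mul_mk, FreeGroup.mul_mk, FreeGroup.toWord_mk,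
    FreeGroup.toWord_mk, List.singleton_append, h₁.reduce_eq, h₂.reduce_eq, hs,
    List.cons_append] at key
  exact hcs (congrArg Prod.fst (List.cons.inj key).1).symm

/-- The length of `x ^ n` is that of a conjugating word and its inverse plus `|n|` times the length
of the cyclic reduction of `x`. -/
theorem FreeGroup.exists_norm_zpow_bounds {X : Type*} [DecidableEq X] {x : FreeGroup X}
    (hx : x ≠ 1) :
    ∃ C r : ℕ, 0 < r ∧ ∀ n : ℤ, n.natAbs * r ≤ (x ^ n).norm ∧ (x ^ n).norm ≤ C + n.natAbs * r := by
  refine ⟨2 * (reduceCyclically.conjugator x.toWord).length, (reduceCyclically x.toWord).length,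
    ?_, fun n => ?_⟩
  · rw [List.length_pos_iff]
    intro h
    have := reduceCyclically.conj_conjugator_reduceCyclically x.toWord
    rw [h, List.append_nil] at this
    apply hx
    rw [← mk_toWord (x := x), ← this, ← mul_mk, ← inv_mk, mul_inv_cancel]
  · have hnorm : (x ^ n).norm = (x ^ n.natAbs).norm := by
      rcases Int.natAbs_eq n with h | h
      · rw [← zpow_natCast, ← h]
      · rw [← zpow_natCast, ← norm_inv_eq (x := x ^ (n.natAbs : ℤ)), ← zpow_neg, ← h]
    rw [hnorm, norm, toWord_pow, reduceCyclically.reduce_flatten_replicate isReduced_toWord]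
    split_ifs with h
    · simp [h]
    · simp only [List.length_append, invRev_length, List.length_flatten, List.map_replicate,
        List.sum_replicate, smul_eq_mul]
      omega

/-- Conjugating `x ^ (i * n)` by `y` changes its length by at most twice the length of `y`, while
the lengths of `x ^ (i * n)` and `x ^ (j * n)` grow like `|i| * n` and `|j| * n`. -/
theorem FreeGroup.natAbs_le_of_conj_zpow_eq_zpow {X : Type*} {x y : FreeGroup X} (hx : x ≠ 1)
    {i j : ℤ} (h : y * x ^ i * y⁻¹ = x ^ j) : j.natAbs ≤ i.natAbs := by
  classical
  obtain ⟨C, r, hr, hb⟩ := FreeGroup.exists_norm_zpow_bounds hx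
  by_contra! hlt
  set n : ℕ := 2 * y.norm + C + 1 with hn
  have hpow : y * x ^ (i * n) * y⁻¹ = x ^ (j * n) := by
    rw [zpow_mul, zpow_mul, ← h, conj_zpow]
  have h₁ := (hb (j * n)).1
  have h₂ := (hb (i * n)).2
  rw [← hpow] at h₁
  have h₃ := FreeGroup.norm_mul_le (y * x ^ (i * n)) y⁻¹
  have h₄ := FreeGroup.norm_mul_le y (x ^ (i * n))
  rw [FreeGroup.norm_inv_eq] at h₃
  rw [Int.natAbs_mul, Int.natAbs_natCast] at h₁ h₂
  have h₅ : (i.natAbs + 1) * n * r ≤ j.natAbs * n * r := by gcongr; omega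
  have h₆ : n ≤ n * r := Nat.le_mul_of_pos_right n hr
  have h₇ : (i.natAbs + 1) * n * r = i.natAbs * n * r + n * r := by ring
  omega

/-! ### Centralizers and conjugates of powers -/

section IsFreeGroup

variable {F : Type*} [Group F] [IsFreeGroup F]

theorem IsFreeGroup.isMulTorsionFree : IsMulTorsionFree F :=
  Function.Injective.isMulTorsionFree (IsFreeGroup.toFreeGroup F).toMonoidHom
    (IsFreeGroup.toFreeGroup F).injective

theorem IsFreeGroup.isCyclic_of_commute_all {g : F} (hg : g ≠ 1) (hc : ∀ x, Commute g x) :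
    IsCyclic F := by
  let e := IsFreeGroup.toFreeGroup F
  have hX : Subsingleton (IsFreeGroup.Generators F) := by
    refine FreeGroup.subsingleton_of_commute_all (x := e g) (by simpa using hg) fun y => ?_
    simpa using (hc (e.symm y)).map e
  rcases isEmpty_or_nonempty (IsFreeGroup.Generators F) with hE | ⟨⟨a⟩⟩
  · exact absurd (e.injective (Subsingleton.elim _ _)) hg
  · have : Unique (IsFreeGroup.Generators F) := uniqueOfSubsingleton a
    exact isCyclic_of_surjective e.symm e.symm.surjective

/-- By the Nielsen–Schreier theorem the centralizer of `g` is free, and `g` is central in it. -/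
theorem IsFreeGroup.isCyclic_centralizer {g : F} (hg : g ≠ 1) :
    IsCyclic (Subgroup.centralizer {g}) := by
  refine IsFreeGroup.isCyclic_of_commute_all
    (g := (⟨g, Subgroup.mem_centralizer_singleton_iff.2 rfl⟩ : Subgroup.centralizer {g}))
    (fun h => hg (congrArg Subtype.val h)) fun x => ?_
  exact Subtype.ext (Subgroup.mem_centralizer_singleton_iff.1 x.2).symm

/-- Comparing lengths gives `j = ± i`. Since roots in `F` are unique, either `y` centralizes `g` or
it inverts `g`; in the second case `y ^ 2` commutes with `g`, hence so does its root `y`. -/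
theorem IsFreeGroup.commute_of_conj_zpow_eq_zpow {g y : F} (hg : g ≠ 1) {i j : ℤ} (hi : i ≠ 0)
    (h : y * g ^ i * y⁻¹ = g ^ j) : Commute y g := by
  have := IsFreeGroup.isMulTorsionFree (F := F)
  let e := IsFreeGroup.toFreeGroup F
  have heg : e g ≠ 1 := by simpa using hg
  have hle : j.natAbs ≤ i.natAbs :=
    FreeGroup.natAbs_le_of_conj_zpow_eq_zpow (y := e y) heg (by simpa using congrArg e h)
  have hge : i.natAbs ≤ j.natAbs := by
    refine FreeGroup.natAbs_le_of_conj_zpow_eq_zpow (y := e y⁻¹) heg ?_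
    have h' : y⁻¹ * g ^ j * y⁻¹⁻¹ = g ^ i := by rw [← h]; group
    simpa using congrArg e h'
  rw [← conj_zpow] at h
  rcases Int.natAbs_eq_natAbs_iff.1 (le_antisymm hge hle) with rfl | rfl
  · exact mul_inv_eq_iff_eq_mul.1 (zpow_left_injective hi h)
  · have hinv : y * g * y⁻¹ = g⁻¹ := by
      refine zpow_left_injective (n := -j) hi ?_
      simpa using h
    have hinv' : y * g⁻¹ * y⁻¹ = g := by
      rw [← conj_inv, hinv, inv_inv]
    have hsq : (g * y * g⁻¹) ^ 2 = y ^ 2 := by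
      have hyy : y ^ 2 * g * (y ^ 2)⁻¹ = g := by
        calc y ^ 2 * g * (y ^ 2)⁻¹ = y * (y * g * y⁻¹) * y⁻¹ := by simp [sq, mul_assoc]
          _ = g := by rw [hinv, hinv']
      rw [conj_pow, ← mul_inv_eq_iff_eq_mul.1 hyy, mul_inv_cancel_right]
    have := pow_left_injective two_ne_zero hsq
    exact (mul_inv_eq_iff_eq_mul.1 this).symm

/-- If `f` does not commute with `z`, the group `⟨z⟩ × ⟨z⟩` acts freely on the
double coset `⟨z⟩ f ⟨z⟩`. -/
theorem IsFreeGroup.eq_zero_of_zpow_mul_mul_zpow_eq {z f : F} (hz : z ≠ 1) (hf : ¬Commute f z)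
    {a b : ℤ} (h : z ^ a * f * z ^ b = f) : a = 0 ∧ b = 0 := by
  have := IsFreeGroup.isMulTorsionFree (F := F)
  have hb : b = 0 := by
    by_contra hb
    refine hf (IsFreeGroup.commute_of_conj_zpow_eq_zpow hz hb (j := -a) ?_)
    rw [zpow_neg, mul_inv_eq_iff_eq_mul, eq_inv_mul_iff_mul_eq, ← mul_assoc]
    exact h
  subst hb
  exact ⟨by simpa [hz] using h, rfl⟩

end IsFreeGroup

/-! ### Commuting elements of a group algebra -/

/-- Let `d > 0` be the largest exponent of `u`, and `I` the largest exponent `a` for which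
some `z ^ a * f * z ^ b` lies in the support of `v`, say for `b = j`. At
`z ^ (d + I) * f * z ^ j` the product `u * v` has the single contribution
`u (z ^ d) * v (z ^ I * f * z ^ j)`, and `v * u` has none. -/
theorem MonoidAlgebra.coeff_eq_zero_of_commute_of_pos {k G : Type*} [Semiring k] [NoZeroDivisors k]
    [Group G] {u v : MonoidAlgebra k G} {z f : G} (huv : u * v = v * u)
    (hf : ∀ a b : ℤ, z ^ a * f * z ^ b = f → a = 0 ∧ b = 0)
    (hu : ∀ x ∈ u.coeff.support, x ∈ Subgroup.zpowers z) {n : ℤ} (hn : 0 < n)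
    (hun : u.coeff (z ^ n) ≠ 0) : v.coeff f = 0 := by
  by_contra hvf
  have hinj : Function.Injective fun p : ℤ × ℤ => z ^ p.1 * f * z ^ p.2 := by
    rintro ⟨a, b⟩ ⟨c, d⟩ h
    have h' : z ^ (a - c) * f * z ^ (b - d) = f := by
      have h₀ : z ^ a * f * z ^ b = z ^ c * f * z ^ d := h
      calc z ^ (a - c) * f * z ^ (b - d) = z ^ (-c) * (z ^ a * f * z ^ b) * z ^ (-d) := by group
        _ = f := by rw [h₀]; group
    obtain ⟨h₁, h₂⟩ := hf _ _ h'
    exact Prod.ext (by dsimp only; omega) (by dsimp only; omega)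
  have hz : Function.Injective fun m : ℤ => z ^ m := by
    intro a b h
    have h₀ : z ^ a = z ^ b := h
    have := hinj (a₁ := (a, 0)) (a₂ := (b, 0)) (by simp [h₀])
    exact congrArg Prod.fst this
  obtain ⟨d, hd, hdmax⟩ := Finset.exists_max_image (u.coeff.support.preimage _ hz.injOn) id
    ⟨n, by simpa using hun⟩
  obtain ⟨⟨I, j⟩, hIj, hImax⟩ := Finset.exists_max_image
    (v.coeff.support.preimage _ hinj.injOn) Prod.fst ⟨(0, 0), by simpa using hvf⟩
  simp only [Finset.mem_preimage, Finsupp.mem_support_iff, id, Prod.forall] at hd hdmax hIj hImax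
  have hd0 : 0 < d := hn.trans_le (hdmax n hun)
  have hl : (u * v).coeff (z ^ (d + I) * f * z ^ j) =
      u.coeff (z ^ d) * v.coeff (z ^ I * f * z ^ j) := by
    rw [MonoidAlgebra.coeff_mul_apply_left, Finsupp.sum, Finset.sum_eq_single (z ^ d)]
    · congr 2
      group
    · intro x hx hxd
      obtain ⟨m, rfl⟩ := hu x hx
      have hmd := hdmax m (by simpa using hx)
      have hne : m ≠ d := fun h => hxd (by rw [h])
      suffices v.coeff (z ^ (d + I - m) * f * z ^ j) = 0 by
        rw [show (z ^ m)⁻¹ * (z ^ (d + I) * f * z ^ j) = z ^ (d + I - m) * f * z ^ j by group,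
          this, mul_zero]
      by_contra hv
      have := hImax _ _ hv
      omega
    · intro h
      rw [Finsupp.notMem_support_iff.1 h, zero_mul]
  have hr : (v * u).coeff (z ^ (d + I) * f * z ^ j) = 0 := by
    rw [MonoidAlgebra.coeff_mul_apply_right, Finsupp.sum]
    refine Finset.sum_eq_zero fun x hx => ?_
    obtain ⟨m, rfl⟩ := hu x hx
    suffices v.coeff (z ^ (d + I) * f * z ^ (j - m)) = 0 by
      rw [show z ^ (d + I) * f * z ^ j * (z ^ m)⁻¹ = z ^ (d + I) * f * z ^ (j - m) by group,
        this, zero_mul]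
    by_contra hv
    have := hImax _ _ hv
    omega
  rw [huv, hr] at hl
  exact mul_ne_zero hd hIj hl.symm

/-- If the exponent `n` is negative, the argument of
`MonoidAlgebra.coeff_eq_zero_of_commute_of_pos` applies with `z⁻¹` in place of `z`. -/
theorem MonoidAlgebra.coeff_eq_zero_of_commute {k G : Type*} [Semiring k] [NoZeroDivisors k]
    [Group G] {u v : MonoidAlgebra k G} {z f : G} (huv : u * v = v * u)
    (hf : ∀ a b : ℤ, z ^ a * f * z ^ b = f → a = 0 ∧ b = 0)
    (hu : ∀ x ∈ u.coeff.support, x ∈ Subgroup.zpowers z) {n : ℤ} (hn : n ≠ 0)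
    (hun : u.coeff (z ^ n) ≠ 0) : v.coeff f = 0 := by
  rcases hn.lt_or_gt with hn | hn
  · refine MonoidAlgebra.coeff_eq_zero_of_commute_of_pos (z := z⁻¹) (n := -n) huv
      (fun a b h => ?_) (by simpa using hu) (by omega) (by simpa using hun)
    simpa using hf (-a) (-b) (by simpa using h)
  · exact MonoidAlgebra.coeff_eq_zero_of_commute_of_pos huv hf hu hn hun

/-! ### Group algebras of subgroups -/

theorem MonoidAlgebra.exists_mem_support_ne_one {k G : Type*} [CommSemiring k] [Monoid G]
    {u : MonoidAlgebra k G} (hu : u ∉ Set.range (algebraMap k (MonoidAlgebra k G))) :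
    ∃ g ∈ u.coeff.support, g ≠ 1 := by
  by_contra! h
  refine hu ⟨u.coeff 1, ?_⟩
  ext g
  rcases eq_or_ne g 1 with rfl | hg
  · simp
  · have : u.coeff g = 0 := by
      by_contra hne
      exact hg (h g (by simpa using hne))
    simp [this, hg.symm]

theorem mem_groupSubalgebra_iff {k F : Type*} [Field k] [Group F] {Z : Subgroup F}
    {u : MonoidAlgebra k F} : u ∈ groupSubalgebra k Z ↔ SupportedOn u Z := by
  classical
  constructor
  · rintro ⟨w, rfl⟩ x hx
    have := Finsupp.mapDomain_support hx
    obtain ⟨y, -, rfl⟩ := Finset.mem_image.1 this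
    exact y.2
  · intro h
    exact ⟨MonoidAlgebra.comapDomain Z.subtype Z.subtype_injective u,
      MonoidAlgebra.mapDomain_comapDomain (by simpa [SupportedOn] using h) Z.subtype_injective⟩

/-- The inclusion `Z → F` is injective, so the image of `k[Z]` in `k[F]` is a copy of `k[Z]`. -/
noncomputable def groupSubalgebraEquiv (k : Type*) [Field k] {F : Type*} [Group F]
    (Z : Subgroup F) : groupSubalgebra k Z ≃ₐ[k] MonoidAlgebra k Z :=
  (AlgEquiv.ofInjective (MonoidAlgebra.mapDomainAlgHom k k Z.subtype)
    (MonoidAlgebra.mapDomain_injective Z.subtype_injective)).symm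

theorem corollary6p3 {k : Type*} [Field k] {F : Type*} [Group F] [IsFreeGroup F]
    (u : MonoidAlgebra k F)
    (hu : u ∉ Set.range (algebraMap k (MonoidAlgebra k F)))
    (hcyc : ∃ Y : Subgroup F, IsCyclic Y ∧ SupportedOn u Y) :
    ∃ Z : Subgroup F,
      IsGreatest {Y : Subgroup F | IsCyclic Y ∧ SupportedOn u Y} Z ∧
      Subalgebra.centralizer k {u} = groupSubalgebra k Z ∧
      Nonempty (groupSubalgebra k Z ≃ₐ[k] MonoidAlgebra k Z) ∧
      Nonempty (groupSubalgebra k Z ≃ₐ[k] LaurentPolynomial k) := by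
  have htf := IsFreeGroup.isMulTorsionFree (F := F)
  -- A cyclic subgroup containing the support contains `g`, so it centralizes `g`; hence the
  -- centralizer of `g`, being cyclic itself, is the largest such subgroup.
  obtain ⟨g, hgu, hg⟩ := MonoidAlgebra.exists_mem_support_ne_one hu
  have hcycZ := IsFreeGroup.isCyclic_centralizer hg
  set Z : Subgroup F := Subgroup.centralizer {g} with hZ
  have hgZ : g ∈ Z := Subgroup.mem_centralizer_singleton_iff.2 rfl
  have hub : ∀ Y : Subgroup F, IsCyclic Y → SupportedOn u Y → Y ≤ Z := by
    intro Y hY hs y hy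
    let _ := IsCyclic.commGroup (α := Y)
    have hcomm : (⟨y, hy⟩ : Y) * ⟨g, hs hgu⟩ = ⟨g, hs hgu⟩ * ⟨y, hy⟩ := mul_comm _ _
    exact Subgroup.mem_centralizer_singleton_iff.2 (congrArg Subtype.val hcomm)
  have huZ : SupportedOn u Z := by
    obtain ⟨Y, hY, hs⟩ := hcyc
    exact hs.trans (hub Y hY hs)
  obtain ⟨z, hz⟩ := (Subgroup.isCyclic_iff_exists_zpowers_eq_top Z).1 hcycZ
  have hz1 : z ≠ 1 := by
    rintro rfl
    rw [Subgroup.zpowers_one_eq_bot] at hz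
    rw [← hz, Subgroup.mem_bot] at hgZ
    exact hg hgZ
  refine ⟨Z, ⟨⟨hcycZ, huZ⟩, fun Y hY => hub Y hY.1 hY.2⟩, ?_, ⟨groupSubalgebraEquiv k Z⟩, ?_⟩
  · ext v
    rw [Subalgebra.mem_centralizer_iff]
    simp only [Set.mem_singleton_iff, forall_eq]
    constructor
    · intro huv
      rw [mem_groupSubalgebra_iff]
      intro f hfv
      by_contra hfZ
      obtain ⟨n, hn⟩ : g ∈ Subgroup.zpowers z := hz ▸ hgZ
      have hn' : z ^ n = g := hn
      have hfz : ¬Commute f z := by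
        intro h
        refine hfZ (Subgroup.mem_centralizer_singleton_iff.2 ?_)
        rw [← hn']
        exact (h.zpow_right n).eq
      refine Finsupp.mem_support_iff.1 hfv (MonoidAlgebra.coeff_eq_zero_of_commute huv
        (fun a b h => IsFreeGroup.eq_zero_of_zpow_mul_mul_zpow_eq hz1 hfz h)
        (fun x hx => hz ▸ huZ hx) (n := n) ?_ ?_)
      · rintro rfl
        exact hg (by simpa using hn'.symm)
      · rw [hn']
        exact Finsupp.mem_support_iff.1 hgu
    · intro hv
      obtain ⟨v', rfl⟩ := hv
      obtain ⟨u', rfl⟩ := mem_groupSubalgebra_iff.2 huZ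
      let _ := IsCyclic.commGroup (α := Z)
      have := congrArg (MonoidAlgebra.mapDomainAlgHom k k Z.subtype) (mul_comm u' v')
      rwa [map_mul, map_mul] at this
  · have hinf : Infinite Z := by
      rw [← hz]
      exact (infinite_zpowers.2 (not_isOfFinOrder_of_isMulTorsionFree hz1)).to_subtype
    exact ⟨(groupSubalgebraEquiv k Z).trans <|
      (MonoidAlgebra.domCongr k k (intCyclicMulEquiv (G := Z)).symm).trans
        (AddMonoidAlgebra.toMultiplicativeAlgEquiv k k ℤ).symm⟩
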